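/- All graphs are finite and have no loops, but may have multiple edges. For a graph $H$, let $\omega(H)$ be the number of connected components of $H$ and $I(H)$ the set of isolated vertices of $H$; for $S\subseteq V(G)$, $G\setminus S$ is the graph obtained from $G$ by deleting the vertices in $S$. For a real function $t$ on $V(G)$, the graph $G$ is called $t$-iso-tough if $\sum_{v\in I(G\setminus S)}t(v)\le |S|$ for all $S\subseteq V(G)$. A near $f$-factor of $G$ is a spanning subgraph $F$ of $G$ such that $d_F(v)=f(v)$ for every vertex $v$, except for at most one vertex $u$ with $d_F(u)=f(u)+1$ (degrees count edges with multiplicity). **Theorem.** Let $G$ be a graph, let $f$ be a positive integer-valued function on $V(G)$, and let $\varepsilon$ be a real number with $0<\varepsilon\le 1$. Suppose that $G$ is $t$-iso-tough for the function $t(v)=f(v)(f(v)+1)/\varepsilon$, and that for all $S\subseteq V(G)$, $$\omega(G\setminus S)<\sum_{v\in S}(f(v)-\varepsilon)+2.$$ Then $G$ has a near $f$-factor. **Corollary** (the case $\varepsilon=1$). Let $G$ be a graph and let $f$ be a positive integer-valued function on $V(G)$. If $G$ is $t$-iso-tough for $t(v)=f(v)(f(v)+1)$ and, for all $S\subseteq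 V(G)$, $$\omega(G\setminus S)\le\sum_{v\in S}(f(v)-1)+1,$$ then $G$ has a near $f$-factor. -/

import Mathlib

namespace Graph

variable {α β : Type*}

/-- The degree of a vertex `v` of a graph without loops: the number of edges incident with `v`
(parallel edges are counted with multiplicity). -/
noncomputable def numIncEdges (G : Graph α β) (v : α) : ℕ :=
  {e | G.Inc e v}.ncard

/-- The set of isolated vertices of `G`. -/
def isolatedVerts (G : Graph α β) : Set α :=
  {v | v ∈ G.vertexSet ∧ ∀ e, ¬ G.Inc e v}

/-- The number `ω(G)` of connected components of `G`. -/
noncomputable def numComponents (G : Graph α β) : ℕ :=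
  Nat.card G.toSimpleGraph.ConnectedComponent

/-- For a real function `t` on the vertices, a (finite) graph `G` is `t`-iso-tough if for every
set `S` of vertices, the sum of `t v` over the isolated vertices `v` of `G ∖ S` is at
most `|S|`. -/
def IsoTough (G : Graph α β) (t : α → ℝ) : Prop :=
  ∀ S : Set α, S ⊆ G.vertexSet →
    ∑ᶠ v ∈ (G.deleteVerts S).isolatedVerts, t v ≤ (S.ncard : ℝ)

/-- `F` is a near `f`-factor of `G`: a spanning subgraph in which every vertex `v` has degree
`f v`, except for at most one vertex `u`, which then has degree `f u + 1`. -/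
def IsNearFactor (F G : Graph α β) (f : α → ℕ) : Prop :=
  F.IsSpanningSubgraph G ∧
    ((∀ v ∈ G.vertexSet, F.numIncEdges v = f v) ∨
      ∃ u ∈ G.vertexSet, F.numIncEdges u = f u + 1 ∧
        ∀ v ∈ G.vertexSet, v ≠ u → F.numIncEdges v = f v)

end Graph

/-! A near `f`-factor is an `(f + κ)`-factor, where `κ` is zero or the indicator of one vertex,
chosen to make the total degree even. By a form of Tutte's factor theorem (`exists_factor`, via
perfect matchings in a gadget graph), it suffices that `surplus` is at least -1 for all disjoint
`S`, `T`; this is `neg_one_le_surplus`.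

Write d for the degree into the complement of `S`. A vertex of `T` with at least f + κ - 1 edges
into `T` can leave `T` without raising the surplus, so assume each has at most f - 1. Split `T` into
`A` (d ≥ 2f) and `B` (d < 2f). The component hypothesis at S ∪ A bounds the surplus of (S, A) from
below with a gain ε(|S| + |A|), and adding `B` costs at most Σ_B (f + κ - 1). A greedy independent
`I ⊆ B` satisfies Σ_B (f - 1) ≤ Σ_I f(f - 1), and iso-toughness at S ∪ N(I), with d ≤ 2f - 1 on `I`,
gives Σ_I (f(f - 1) + 1) ≤ ε|S|. So the gain covers the cost, and the extra |I| ≥ 1 pays for `κ`. -/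

namespace SimpleGraph

/-! ### Components under adding a vertex, and minimal Tutte violators. -/

variable {V W : Type*}

lemma Reachable.mem_of_closed {K : SimpleGraph V} {P : Set V}
    (hP : ∀ a ∈ P, ∀ b, K.Adj a b → b ∈ P) {a b : V} (h : K.Reachable a b) (ha : a ∈ P) :
    b ∈ P := by
  obtain ⟨p⟩ := h
  induction p with
  | nil => exact ha
  | cons hadj _ ih => exact ih (hP _ ha _ hadj)

/-- The image of `c` under `φ` is closed under adjacency. -/
def ConnectedComponent.ClosedUnder {K : SimpleGraph V} {K' : SimpleGraph W} (φ : K →g K')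
    (c : K.ConnectedComponent) : Prop :=
  ∀ a ∈ c.supp, ∀ b', K'.Adj (φ a) b' → ∃ b, K.Adj a b ∧ φ b = b'

lemma ConnectedComponent.ClosedUnder.supp_map {K : SimpleGraph V} {K' : SimpleGraph W}
    {φ : K →g K'} {c : K.ConnectedComponent} (h : c.ClosedUnder φ) :
    (c.map φ).supp = φ '' c.supp := by
  induction c using ConnectedComponent.ind with | _ v
  ext w
  constructor
  · intro hw
    have hw : K'.Reachable (φ v) w := by
      have := ConnectedComponent.mem_supp_iff _ _ |>.1 hw
      rw [ConnectedComponent.map_mk, ConnectedComponent.eq] at this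
      exact this.symm
    refine hw.mem_of_closed ?_ ⟨v, rfl, rfl⟩
    rintro _ ⟨a, ha, rfl⟩ b' hb'
    obtain ⟨b, hab, rfl⟩ := h a ha b' hb'
    exact ⟨b, (ConnectedComponent.mem_supp_congr_adj _ hab).1 ha, rfl⟩
  · rintro ⟨a, ha, rfl⟩
    have ha := ConnectedComponent.mem_supp_iff _ _ |>.1 ha
    rw [ConnectedComponent.mem_supp_iff, ← ha, ConnectedComponent.map_mk]

lemma injOn_map_closedUnder {K : SimpleGraph V} {K' : SimpleGraph W} (φ : K →g K')
    (hφ : Function.Injective φ) :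
    Set.InjOn (ConnectedComponent.map φ) {c : K.ConnectedComponent | c.ClosedUnder φ} := by
  intro c hc d hd h
  apply ConnectedComponent.supp_injective
  apply hφ.image_injective
  rw [← ConnectedComponent.ClosedUnder.supp_map hc, ← ConnectedComponent.ClosedUnder.supp_map hd, h]

/-- A closed component is carried onto a whole component of the same size, so parity is kept and
distinct ones stay distinct. -/
lemma ncard_oddComponents_closedUnder_le [Finite W] {K : SimpleGraph V} {K' : SimpleGraph W}
    (φ : K →g K') (hφ : Function.Injective φ) :
    {c ∈ K.oddComponents | c.ClosedUnder φ}.ncard ≤ K'.oddComponents.ncard := by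
  refine Set.ncard_le_ncard_of_injOn (ConnectedComponent.map φ) ?_
    ((injOn_map_closedUnder φ hφ).mono fun c hc => hc.2) (Set.toFinite _)
  rintro c ⟨hc, hcl⟩
  change Odd (c.map φ).supp.ncard
  rw [hcl.supp_map, Set.ncard_image_of_injective _ hφ]
  exact hc

/-- The components of `K` that contain a neighbour of `x ∉ X` when `K` is restricted to `X`. -/
def touchingComponents (K : SimpleGraph V) (X : Set V) (x : V) :
    Set (K.induce X).ConnectedComponent :=
  (K.induce X).connectedComponentMk '' {w | K.Adj x w}

lemma closedUnder_of_notMem_touching {K : SimpleGraph V} {X Y : Set V} {x : V}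
    (hXY : X ⊆ Y) (hYX : Y ⊆ insert x X)
    {c : (K.induce X).ConnectedComponent} (hc : c ∉ K.touchingComponents X x) :
    c.ClosedUnder (K.induceHomOfLE hXY).toHom := by
  rintro a ha ⟨b, hb⟩ hab
  have hab : K.Adj a b := hab
  rcases hYX hb with rfl | hbX
  · exact absurd ⟨a, hab.symm, ha⟩ hc
  · exact ⟨⟨b, hbX⟩, hab, rfl⟩

lemma ncard_oddComponents_le_add_touching [Finite V] (K : SimpleGraph V) {X Y : Set V} {x : V}
    (hXY : X ⊆ Y) (hYX : Y ⊆ insert x X) :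
    (K.induce X).oddComponents.ncard ≤
      (K.induce Y).oddComponents.ncard + (K.touchingComponents X x).ncard := by
  refine le_trans ?_ (Nat.add_le_add_right (ncard_oddComponents_closedUnder_le
    (K.induceHomOfLE hXY).toHom (K.induceHomOfLE hXY).injective) _)
  refine le_trans (Set.ncard_le_ncard ?_ (Set.toFinite _)) (Set.ncard_union_le _ _)
  intro c hc
  by_cases h : c ∈ K.touchingComponents X x
  · exact Or.inr h
  · exact Or.inl ⟨hc, closedUnder_of_notMem_touching hXY hYX h⟩

/-- The number of components of the subgraph induced on `X`. -/
noncomputable def inducedComponents (K : SimpleGraph V) (X : Set V) : ℕ :=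
  Nat.card (K.induce X).ConnectedComponent

/-- Components not touching `x` survive, the component of `x` is a further one, and each touching
component uses up a neighbour of `x`. -/
lemma inducedComponents_add_one_le [Finite V] (K : SimpleGraph V) {X Y : Set V} {x : V}
    (hx : x ∉ X) (hY : Y = insert x X) :
    K.inducedComponents X + 1 ≤ K.inducedComponents Y + {w ∈ X | K.Adj x w}.ncard := by
  subst hY
  have hXY : X ⊆ insert x X := Set.subset_insert x X
  set φ := (K.induceHomOfLE hXY).toHom
  set cx := (K.induce (insert x X)).connectedComponentMk ⟨x, Set.mem_insert x X⟩
  have h1 : (K.touchingComponents X x)ᶜ.ncard ≤ ({cx}ᶜ : Set _).ncard := by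
    refine Set.ncard_le_ncard_of_injOn (ConnectedComponent.map φ) ?_
      ((injOn_map_closedUnder φ (K.induceHomOfLE hXY).injective).mono
        fun c hc => closedUnder_of_notMem_touching hXY subset_rfl hc) (Set.toFinite _)
    intro c hc h
    have hs := (closedUnder_of_notMem_touching hXY subset_rfl hc).supp_map
    have : (⟨x, Set.mem_insert x X⟩ : ↥(insert x X)) ∈ (c.map φ).supp := by
      rw [Set.mem_singleton_iff.1 h]; rfl
    rw [hs] at this
    obtain ⟨a, -, ha⟩ := this
    have hax : (a : V) = x := congrArg Subtype.val ha
    exact hx (hax ▸ a.2)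
  have h2 : (K.touchingComponents X x).ncard ≤ {w ∈ X | K.Adj x w}.ncard := by
    refine (Set.ncard_image_le (Set.toFinite _)).trans ?_
    refine Set.ncard_le_ncard_of_injOn Subtype.val ?_ Subtype.val_injective.injOn (Set.toFinite _)
    intro w hw
    exact ⟨w.2, hw⟩
  have h3 := Set.ncard_add_ncard_compl (K.touchingComponents X x)
  have h4 := Set.ncard_add_ncard_compl ({cx} : Set (K.induce (insert x X)).ConnectedComponent)
  rw [Set.ncard_singleton] at h4
  unfold inducedComponents
  omega

lemma IsTutteViolator.lt_oddComponents_induce [Finite V] {K : SimpleGraph V} {U : Set V} :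
    K.IsTutteViolator U → U.ncard < (K.induce Uᶜ).oddComponents.ncard := by
  intro h
  refine h.trans_le ?_
  let φ : ((⊤ : K.Subgraph).deleteVerts U).coe →g K.induce Uᶜ :=
    { toFun := fun a => ⟨a.1, a.2.2⟩
      map_rel' := fun {a b} hab => by
        exact ((Subgraph.deleteVerts ⊤ U).adj_sub hab :) }
  have hφ : Function.Injective φ := fun a b h => Subtype.ext (congrArg (fun z => z.1) h)
  refine le_trans (Set.ncard_le_ncard ?_ (Set.toFinite _))
    (ncard_oddComponents_closedUnder_le φ hφ)
  intro c hc
  refine ⟨hc, ?_⟩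
  rintro a - ⟨b, hb⟩ hab
  have hab : K.Adj a b := hab
  refine ⟨⟨b, by simpa using hb⟩, ?_, rfl⟩
  rw [Subgraph.coe_adj, Subgraph.deleteVerts_adj]
  exact ⟨by simp, a.2.2, by simp, hb, by simpa using hab⟩

/-- If an even graph has no perfect matching, then a smallest Tutte violator `U` is such that every
vertex of `U` has neighbours in at least three components of the rest. -/
lemma exists_minimal_tutteViolator [Finite V] (K : SimpleGraph V) (heven : Even (Nat.card V))
    (hK : ∀ M : K.Subgraph, ¬ M.IsPerfectMatching) :
    ∃ U : Set V, U.ncard + 2 ≤ (K.induce Uᶜ).oddComponents.ncard ∧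
      ∀ x ∈ U, 3 ≤ (K.touchingComponents Uᶜ x).ncard := by
  have hne : {U : Set V | U.ncard < (K.induce Uᶜ).oddComponents.ncard}.Nonempty := by
    by_contra hno
    obtain ⟨M, hM⟩ := (tutte (G := K)).2 fun U hU => hno ⟨U, hU.lt_oddComponents_induce⟩
    exact hK M hM
  obtain ⟨U, hU, hmin⟩ := Set.exists_min_image _ Set.ncard (Set.toFinite _) hne
  have hU : U.ncard < (K.induce Uᶜ).oddComponents.ncard := hU
  -- The number of odd components has the parity of |Uᶜ|, hence of |U|, so an excess of one is
  -- impossible.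
  have hpar : U.ncard + 2 ≤ (K.induce Uᶜ).oddComponents.ncard := by
    have h1 := odd_ncard_oddComponents (K.induce Uᶜ)
    rw [Nat.card_coe_set_eq] at h1
    have h2 := Set.ncard_add_ncard_compl U
    rw [← h2] at heven
    by_contra hlt
    have : (K.induce Uᶜ).oddComponents.ncard = U.ncard + 1 := by omega
    rw [this] at h1
    grind
  refine ⟨U, hpar, fun x hx => ?_⟩
  -- If `x` touched at most two components, moving it out of `U` would lose at most two odd ones,
  -- leaving a smaller violator.
  by_contra hlt
  have h1 := K.ncard_oddComponents_le_add_touching (X := Uᶜ) (Y := (U \ {x})ᶜ) (x := x)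
    (by intro y hy h; exact hy h.1) (by intro y hy; by_cases h : y = x <;> grind)
  have h2 : (U \ {x}).ncard + 1 = U.ncard := Set.ncard_sdiff_singleton_add_one hx (Set.toFinite _)
  have h3 : ¬ (U \ {x}).ncard < (K.induce (U \ {x})ᶜ).oddComponents.ncard := fun h => by
    have := hmin _ h
    omega
  omega

end SimpleGraph

/-! ### The lower bound on the surplus. -/

namespace SimpleGraph

variable {V : Type*} [DecidableEq V]

/-- Greedy choice of a heavy independent set. -/
lemma exists_independent_weight_le (D : SimpleGraph V) (m : V → V → ℕ)
    (hm : ∀ v w, D.Adj v w → 1 ≤ m v w) (ω : V → ℕ) (B : Finset V) :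
    ∃ I ⊆ B, (B.Nonempty → I.Nonempty) ∧ (∀ a ∈ I, ∀ b ∈ I, ¬ D.Adj a b) ∧
      ∑ v ∈ B, ω v ≤ ∑ v ∈ I, ω v * (1 + ∑ w ∈ B, m v w) := by
  classical
  induction B using Finset.strongInduction with | _ B ih
  rcases B.eq_empty_or_nonempty with rfl | hB
  · exact ⟨∅, by simp⟩
  -- The heaviest vertex outweighs each neighbour, so `ω v` times its degree pays for discarding
  -- them all.
  obtain ⟨v, hv, hmax⟩ := B.exists_max_image ω hB
  set N := B.filter (D.Adj v) with hN
  set C := B.filter (fun w => w ≠ v ∧ ¬ D.Adj v w) with hC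
  have hCB : C ⊂ B := by
    refine (Finset.ssubset_iff_of_subset (Finset.filter_subset _ _)).2 ⟨v, hv, by simp⟩
  obtain ⟨I, hIC, -, hind, hsum⟩ := ih C hCB
  have hvI : v ∉ I := fun h => by simpa [hC] using hIC h
  refine ⟨insert v I, ?_, fun _ => ⟨v, by simp⟩, ?_, ?_⟩
  · exact Finset.insert_subset hv (hIC.trans hCB.1)
  · intro a ha b hb hab
    rw [Finset.mem_insert] at ha hb
    rcases ha with rfl | ha <;> rcases hb with rfl | hb
    · exact hab.ne rfl
    · exact (Finset.mem_filter.1 (hIC hb)).2.2 hab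
    · exact (Finset.mem_filter.1 (hIC ha)).2.2 hab.symm
    · exact hind a ha b hb hab
  · rw [Finset.sum_insert hvI]
    have hsplit : B ⊆ insert v (N ∪ C) := by
      intro w hw
      by_cases h1 : w = v <;> by_cases h2 : D.Adj v w <;> simp [hN, hC, hw, h1, h2]
    have h1 : ∑ w ∈ B, ω w ≤ ω v + (∑ w ∈ N, ω w + ∑ w ∈ C, ω w) := by
      refine (Finset.sum_le_sum_of_subset hsplit).trans ?_
      rw [Finset.sum_insert (by simp [hN, hC]), ← Finset.sum_union_inter]
      omega
    have h2 : ∑ w ∈ N, ω w ≤ ω v * ∑ w ∈ B, m v w := by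
      rw [Finset.mul_sum]
      refine (Finset.sum_le_sum fun w hw => ?_).trans
        (Finset.sum_le_sum_of_subset (Finset.filter_subset (D.Adj v) B))
      rw [Finset.mem_filter] at hw
      exact (hmax w hw.1).trans (Nat.le_mul_of_pos_right _ (hm v w hw.2))
    have h3 : ∑ v ∈ I, ω v * (1 + ∑ w ∈ C, m v w) ≤ ∑ v ∈ I, ω v * (1 + ∑ w ∈ B, m v w) := by
      gcongr
    rw [mul_add, mul_one]
    omega

variable [Fintype V]

/-- The quantity `f(S) + ∑_{v ∈ T} (d_{G ∖ S}(v) - g(v)) - ω(G ∖ (S ∪ T))`. -/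
noncomputable def surplus (D : SimpleGraph V) (m : V → V → ℕ) (f g : V → ℕ) (S T : Finset V) : ℤ :=
  ∑ v ∈ S, (f v : ℤ) + ∑ v ∈ T, (∑ w ∈ Sᶜ, (m v w : ℤ) - g v) -
    D.inducedComponents (↑(S ∪ T) : Set V)ᶜ

/-- Edges from `v` to the vertices outside `S` and `insert v T` pay for the components that removing
`v` may create; only those into `insert v T` remain as gain. -/
lemma surplus_insert_le (D : SimpleGraph V) (m : V → V → ℕ)
    (hm : ∀ v w, D.Adj v w → 1 ≤ m v w) (f g : V → ℕ) {S T : Finset V} {v : V}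
    (hS : v ∉ S) (hT : v ∉ T) (hdisj : Disjoint S T) :
    D.surplus m f g S T + (∑ w ∈ insert v T, (m v w : ℤ) + 1 - g v) ≤
      D.surplus m f g S (insert v T) := by
  unfold surplus
  have h1 := D.inducedComponents_add_one_le (X := (↑(S ∪ insert v T) : Set V)ᶜ)
    (Y := (↑(S ∪ T) : Set V)ᶜ) (x := v) (by simp) (by
      ext w; by_cases h : w = v <;> simp_all)
  have h2 : {w ∈ (↑(S ∪ insert v T) : Set V)ᶜ | D.Adj v w}.ncard ≤
      ∑ w ∈ (S ∪ insert v T)ᶜ, m v w := by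
    classical
    have : {w ∈ (↑(S ∪ insert v T) : Set V)ᶜ | D.Adj v w} =
        ↑((S ∪ insert v T)ᶜ.filter (D.Adj v)) := by
      ext w; simp
    rw [this, Set.ncard_coe_finset, Finset.card_eq_sum_ones]
    refine (Finset.sum_le_sum fun w hw => ?_).trans
      (Finset.sum_le_sum_of_subset (Finset.filter_subset (D.Adj v) _))
    exact hm v w (Finset.mem_filter.1 hw).2
  have h3 : ∑ w ∈ Sᶜ, m v w = ∑ w ∈ insert v T, m v w + ∑ w ∈ (S ∪ insert v T)ᶜ, m v w := by
    rw [← Finset.sum_union]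
    · congr 1
      ext w
      have : w ∈ S → w ∉ T := fun h => Finset.disjoint_left.1 hdisj h
      by_cases h : w = v <;> simp_all
      tauto
    · rw [Finset.disjoint_left]; intro w; simp; tauto
  zify at h1 h2 h3
  simp only [Finset.sum_insert hT, Finset.coe_union, Finset.coe_insert] at h3 ⊢
  linarith

lemma surplus_union_le (D : SimpleGraph V) (m : V → V → ℕ)
    (hm : ∀ v w, D.Adj v w → 1 ≤ m v w) (f g : V → ℕ) {S A : Finset V} (hSA : Disjoint S A)
    (B : Finset V) (hSB : Disjoint S B) (hAB : Disjoint A B) :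
    D.surplus m f g S A - ∑ v ∈ B, ((g v : ℤ) - 1) ≤ D.surplus m f g S (A ∪ B) := by
  induction B using Finset.induction_on with
  | empty => simp
  | insert v B hv ih =>
    rw [Finset.disjoint_insert_right] at hSB hAB
    have h1 := surplus_insert_le D m hm f g (S := S) (T := A ∪ B) (v := v) hSB.1
      (by simp [hAB.1, hv]) (Finset.disjoint_union_right.2 ⟨hSA, hSB.2⟩)
    have h2 := ih hSB.2 hAB.2
    rw [Finset.sum_insert hv, Finset.union_insert]
    have h3 : (0 : ℤ) ≤ ∑ w ∈ insert v (A ∪ B), (m v w : ℤ) :=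
      Finset.sum_nonneg fun _ _ => Int.natCast_nonneg _
    linarith

/-- Deleting `S` and the neighbours of `I` isolates `I`; outside `S` there are at most as many
neighbours as edges leaving `I`. -/
lemma sum_le_card_of_independent (D : SimpleGraph V) (m : V → V → ℕ)
    (hm : ∀ v w, D.Adj v w → 1 ≤ m v w) (f : V → ℕ) (ε : ℝ) (hε0 : 0 < ε)
    (hiso : ∀ S I : Finset V, (∀ v ∈ I, v ∉ S ∧ ∀ w, D.Adj v w → w ∈ S) →
      ∑ v ∈ I, (f v : ℝ) * (f v + 1) / ε ≤ S.card)
    {S I : Finset V} (hSI : Disjoint S I)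
    (hI : ∀ a ∈ I, ∀ b ∈ I, ¬ D.Adj a b) :
    ∑ v ∈ I, ((f v : ℝ) * (f v + 1) - ε * ∑ w ∈ Sᶜ, (m v w : ℝ)) ≤ ε * S.card := by
  classical
  set N := Finset.univ.filter (fun w => w ∉ S ∧ ∃ v ∈ I, D.Adj v w) with hN
  have h1 := hiso (S ∪ N) I (by
    intro v hv
    refine ⟨?_, fun w hw => ?_⟩
    · simp only [hN, Finset.mem_union, Finset.mem_filter, Finset.mem_univ, true_and, not_or,
        not_and, not_exists]
      exact ⟨Finset.disjoint_right.1 hSI hv, fun _ a ha => hI a ha v hv⟩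
    · by_cases hwS : w ∈ S
      · simp [hwS]
      · simp only [hN, Finset.mem_union, Finset.mem_filter, Finset.mem_univ, true_and]
        exact Or.inr ⟨hwS, v, hv, hw⟩)
  have h2 : N.card ≤ ∑ v ∈ I, ∑ w ∈ Sᶜ, m v w := by
    have : N ⊆ I.biUnion fun v => Sᶜ.filter (D.Adj v) := by
      intro w
      simp only [hN, Finset.mem_filter, Finset.mem_univ, true_and, Finset.mem_biUnion,
        Finset.mem_compl]
      rintro ⟨hw, v, hv, hvw⟩
      exact ⟨v, hv, hw, hvw⟩
    refine (Finset.card_le_card this).trans (Finset.card_biUnion_le.trans ?_)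
    refine Finset.sum_le_sum fun v _ => ?_
    rw [Finset.card_eq_sum_ones]
    refine (Finset.sum_le_sum fun w hw => ?_).trans
      (Finset.sum_le_sum_of_subset (Finset.filter_subset (D.Adj v) _))
    exact hm v w (Finset.mem_filter.1 hw).2
  have h3 : ((S ∪ N).card : ℝ) ≤ S.card + ∑ v ∈ I, ∑ w ∈ Sᶜ, (m v w : ℝ) := by
    have := (Finset.card_union_le S N).trans (Nat.add_le_add_left h2 _)
    exact_mod_cast this
  have h4 := h1.trans h3
  rw [← Finset.sum_div, div_le_iff₀ hε0] at h4
  rw [Finset.sum_sub_distrib, ← Finset.mul_sum]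
  linarith

lemma neg_one_le_surplus (D : SimpleGraph V) (m : V → V → ℕ)
    (hm : ∀ v w, D.Adj v w → 1 ≤ m v w) (f κ : V → ℕ) (hf : ∀ v, 0 < f v)
    (hκ : ∑ v, κ v ≤ 1) (ε : ℝ) (hε0 : 0 < ε) (hε1 : ε ≤ 1)
    (hiso : ∀ S I : Finset V, (∀ v ∈ I, v ∉ S ∧ ∀ w, D.Adj v w → w ∈ S) →
      ∑ v ∈ I, (f v : ℝ) * (f v + 1) / ε ≤ S.card)
    (hcomp : ∀ S : Finset V,
      (D.inducedComponents (↑S : Set V)ᶜ : ℝ) < ∑ v ∈ S, ((f v : ℝ) - ε) + 2)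
    (S : Finset V) (T : Finset V) (hST : Disjoint S T) :
    -1 ≤ D.surplus m f (f + κ) S T := by
  classical
  induction T using Finset.strongInduction with | _ T ih
  by_cases hbig : ∃ v ∈ T, (f v + κ v : ℤ) ≤ ∑ w ∈ T, (m v w : ℤ) + 1
  · obtain ⟨v, hv, hle⟩ := hbig
    have h1 := surplus_insert_le D m hm f (f + κ) (S := S) (T := T.erase v) (v := v)
      (Finset.disjoint_right.1 hST hv) (Finset.notMem_erase v T)
      (hST.mono_right (Finset.erase_subset v T))
    have h2 := ih _ (Finset.erase_ssubset hv) (hST.mono_right (Finset.erase_subset v T))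
    rw [Finset.insert_erase hv] at h1
    simp only [Pi.add_apply] at h1
    push_cast at h1
    linarith
  push Not at hbig
  -- The surplus is an integer, so the strict component bound suffices.
  suffices h : (-2 : ℝ) < D.surplus m f (f + κ) S T by
    have : (-2 : ℤ) < D.surplus m f (f + κ) S T := by exact_mod_cast h
    linarith
  set d : V → ℕ := fun v => ∑ w ∈ Sᶜ, m v w with hd
  set A := T.filter (fun v => 2 * f v ≤ d v) with hA
  set B := T.filter (fun v => ¬ 2 * f v ≤ d v) with hB
  have hAB : Disjoint A B := Finset.disjoint_filter_filter_not _ _ _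
  have hT : A ∪ B = T := Finset.filter_union_filter_not_eq _ _
  have hSA : Disjoint S A := hST.mono_right (Finset.filter_subset _ _)
  have hSB : Disjoint S B := hST.mono_right (Finset.filter_subset _ _)
  have hκ1 : ∀ v, κ v ≤ 1 := fun v =>
    (Finset.single_le_sum (f := κ) (fun _ _ => Nat.zero_le _) (Finset.mem_univ v)).trans hκ
  have hκAB : ∑ v ∈ A, (κ v : ℝ) + ∑ v ∈ B, (κ v : ℝ) ≤ 1 := by
    have : ∑ v ∈ A, κ v + ∑ v ∈ B, κ v ≤ 1 := by
      rw [← Finset.sum_union hAB]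
      exact (Finset.sum_le_sum_of_subset (Finset.subset_univ _)).trans hκ
    exact_mod_cast this
  have hunion := surplus_union_le D m hm f (f + κ) hSA B hSB hAB
  rw [hT] at hunion
  have hunion : (D.surplus m f (f + κ) S A : ℝ) - ∑ v ∈ B, ((f v : ℝ) - 1) - ∑ v ∈ B, (κ v : ℝ) ≤
      D.surplus m f (f + κ) S T := by
    rw [sub_sub, ← Finset.sum_add_distrib]
    have : ((D.surplus m f (f + κ) S A - ∑ v ∈ B, (((f + κ) v : ℕ) - 1 : ℤ) : ℤ) : ℝ) ≤
      D.surplus m f (f + κ) S T := by exact_mod_cast hunion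
    push_cast at this
    refine le_trans (le_of_eq ?_) this
    congr 1
    refine Finset.sum_congr rfl fun v _ => ?_
    simp only [Pi.add_apply]
    push_cast
    ring
  -- The second f in 2f comes from the component bound for S ∪ A.
  have hbase : (∑ v ∈ A, ((d v : ℝ) - 2 * f v - κ v)) + ε * (S.card + A.card) - 2 <
      (D.surplus m f (f + κ) S A : ℝ) := by
    have hc := hcomp (S ∪ A)
    rw [Finset.sum_union hSA] at hc
    simp only [Finset.sum_sub_distrib, Finset.sum_const, nsmul_eq_mul] at hc
    simp only [surplus, hd, Pi.add_apply]
    push_cast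
    simp only [Finset.sum_sub_distrib, Finset.sum_add_distrib, ← Finset.mul_sum]
    push_cast at hc
    linarith
  have hεA : 0 ≤ ε * A.card := by positivity
  rcases B.eq_empty_or_nonempty with hB0 | hBne
  · rw [hB0, Finset.sum_empty, Finset.sum_empty] at hunion
    suffices 0 ≤ (∑ v ∈ A, ((d v : ℝ) - 2 * f v - κ v)) + ε * (S.card + A.card) by linarith
    -- Without `B`, only a vertex with d = 2f and κ = 1 can hurt. Iso-toughness for {u} then gives
    -- ε(|S| + 1) ≥ f(f + 1) - ε(2f - 1) ≥ 1.
    by_cases hbad : ∃ u ∈ A, d u < 2 * f u + κ u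
    · obtain ⟨u, hu, hlt⟩ := hbad
      have huA := (Finset.mem_filter.1 hu).2
      have hdu : d u = 2 * f u := by have := hκ1 u; omega
      have h1 := D.sum_le_card_of_independent m hm f ε hε0 hiso (S := S) (I := {u})
        (Finset.disjoint_singleton_right.2 (Finset.disjoint_right.1 hSA hu))
        (by simp)
      rw [Finset.sum_singleton] at h1
      have hdr : (∑ w ∈ Sᶜ, (m u w : ℝ)) = 2 * f u := by exact_mod_cast hdu
      rw [hdr] at h1
      have h2 : (1 : ℝ) ≤ A.card := by exact_mod_cast Finset.card_pos.2 ⟨u, hu⟩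
      have h3 : (1 : ℝ) ≤ f u := by exact_mod_cast hf u
      have h4 : -(∑ v ∈ A, (κ v : ℝ)) ≤ ∑ v ∈ A, ((d v : ℝ) - 2 * f v - κ v) := by
        rw [← Finset.sum_neg_distrib]
        refine Finset.sum_le_sum fun v hv => ?_
        have : (2 * f v : ℝ) ≤ d v := by exact_mod_cast (Finset.mem_filter.1 hv).2
        linarith
      rw [hB0, Finset.sum_empty] at hκAB
      nlinarith
    · push Not at hbad
      have : 0 ≤ ∑ v ∈ A, ((d v : ℝ) - 2 * f v - κ v) := Finset.sum_nonneg fun v hv => by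
        have : (2 * f v + κ v : ℝ) ≤ d v := by exact_mod_cast hbad v hv
        linarith
      positivity
  · obtain ⟨I, hIB, hIne, hind, hsum⟩ :=
      D.exists_independent_weight_le m hm (fun v => f v - 1) B
    have hI1 : 1 ≤ I.card := Finset.card_pos.2 (hIne hBne)
    have h1 := D.sum_le_card_of_independent m hm f ε hε0 hiso (S := S) (I := I)
      (hSB.mono_right hIB) hind
    -- Termwise, f(f + 1) - εd ≥ f(f + 1) - (2f - 1) = f(f - 1) + 1, and 1 plus the degree into `B`
    -- is at most f.
    have h2 : ∑ v ∈ I, (((f v - 1 : ℕ) * (1 + ∑ w ∈ B, m v w) : ℕ) : ℝ) + I.card ≤ ε * S.card := by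
      refine le_trans ?_ h1
      rw [Finset.card_eq_sum_ones, Nat.cast_sum, ← Finset.sum_add_distrib]
      refine Finset.sum_le_sum fun v hv => ?_
      have hvB := Finset.mem_filter.1 (hIB hv)
      have hT' := hbig v hvB.1
      have hBT : ∑ w ∈ B, (m v w : ℤ) ≤ ∑ w ∈ T, (m v w : ℤ) :=
        Finset.sum_le_sum_of_subset_of_nonneg (Finset.filter_subset _ _)
          fun _ _ _ => Int.natCast_nonneg _
      have hκv : (κ v : ℤ) ≤ 1 := by exact_mod_cast hκ1 v
      have hb : (∑ w ∈ B, m v w : ℤ) + 1 ≤ f v := by linarith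
      have hbr : (∑ w ∈ B, (m v w : ℝ)) + 1 ≤ f v := by exact_mod_cast hb
      have hdv : (∑ w ∈ Sᶜ, (m v w : ℝ)) + 1 ≤ 2 * f v := by
        have : d v + 1 ≤ 2 * f v := by omega
        exact_mod_cast this
      have hd0 : 0 ≤ ∑ w ∈ Sᶜ, (m v w : ℝ) := Finset.sum_nonneg fun _ _ => Nat.cast_nonneg _
      have hfv : (1 : ℝ) ≤ f v := by exact_mod_cast hf v
      push_cast [Nat.cast_sub (hf v)]
      nlinarith
    have h3 : ∑ v ∈ B, ((f v : ℝ) - 1) + 1 ≤ ε * S.card := by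
      refine le_trans ?_ h2
      have h4 : (∑ v ∈ B, ((f v - 1 : ℕ) : ℝ)) ≤
          ∑ v ∈ I, (((f v - 1 : ℕ) * (1 + ∑ w ∈ B, m v w) : ℕ) : ℝ) := by exact_mod_cast hsum
      have h5 : (1 : ℝ) ≤ I.card := by exact_mod_cast hI1
      have h6 : ∑ v ∈ B, ((f v : ℝ) - 1) = ∑ v ∈ B, ((f v - 1 : ℕ) : ℝ) :=
        Finset.sum_congr rfl fun v _ => by push_cast [Nat.cast_sub (hf v)]; ring
      linarith
    have h4 : -(∑ v ∈ A, (κ v : ℝ)) ≤ ∑ v ∈ A, ((d v : ℝ) - 2 * f v - κ v) := by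
      rw [← Finset.sum_neg_distrib]
      refine Finset.sum_le_sum fun v hv => ?_
      have : (2 * f v : ℝ) ≤ d v := by exact_mod_cast (Finset.mem_filter.1 hv).2
      linarith
    linarith

end SimpleGraph

/-! ### Tutte's gadget and the factor theorem. -/

namespace SimpleGraph

variable {V P : Type*}

/-- Tutte's gadget: every vertex `v` is replaced by `g v` copies, and every edge by its two darts,
which are adjacent to each other; a dart is adjacent to all copies of its source. -/
def factorGadget (g : V → ℕ) (src : P → V) (rev : P → P) : SimpleGraph ((Σ v, Fin (g v)) ⊕ P) :=
  fromRel fun x y => match x, y with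
    | .inl c, .inr p => src p = c.1
    | .inr p, .inr q => rev p = q
    | _, _ => False

section Gadget

variable {g : V → ℕ} {src : P → V} {rev : P → P}

@[simp]
lemma factorGadget_adj_inl_inl {c c' : Σ v, Fin (g v)} :
    ¬ (factorGadget g src rev).Adj (.inl c) (.inl c') := by
  simp [factorGadget]

@[simp]
lemma factorGadget_adj_inl_inr {c : Σ v, Fin (g v)} {p : P} :
    (factorGadget g src rev).Adj (.inl c) (.inr p) ↔ src p = c.1 := by
  simp [factorGadget]

@[simp]
lemma factorGadget_adj_inr_inl {c : Σ v, Fin (g v)} {p : P} :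
    (factorGadget g src rev).Adj (.inr p) (.inl c) ↔ src p = c.1 := by
  simp [factorGadget]

lemma factorGadget_adj_inr_inr (hrev : Function.Involutive rev) (hne : ∀ p, rev p ≠ p) {p q : P} :
    (factorGadget g src rev).Adj (.inr p) (.inr q) ↔ rev p = q := by
  simp only [factorGadget, fromRel_adj, ne_eq, Sum.inr.injEq]
  constructor
  · rintro ⟨-, h | h⟩
    · exact h
    · rw [← h, hrev]
  · rintro rfl
    exact ⟨(hne p).symm, Or.inl rfl⟩

/-- A perfect matching of the gadget selects a set of edges with degrees `g`. -/
lemma exists_factor_of_isPerfectMatching [Finite P] (hrev : Function.Involutive rev)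
    (hne : ∀ p, rev p ≠ p) {M : (factorGadget g src rev).Subgraph} (hM : M.IsPerfectMatching) :
    ∃ Q : Set P, (∀ p ∈ Q, rev p ∈ Q) ∧ ∀ v, {p ∈ Q | src p = v}.ncard = g v := by
  have hM' := Subgraph.isPerfectMatching_iff.1 hM
  -- A dart matched to a copy is not matched to its reverse, so the reverse must also be matched to
  -- a copy.
  refine ⟨{p | ∃ c, M.Adj (.inr p) (.inl c)}, ?_, fun v => ?_⟩
  · rintro p ⟨c, hc⟩
    obtain ⟨y, hy, -⟩ := hM' (.inr (rev p))
    rcases y with c' | q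
    · exact ⟨c', hy⟩
    · have hq := (factorGadget_adj_inr_inr hrev hne).1 hy.adj_sub
      rw [hrev] at hq
      subst hq
      have := (hM' (.inr p)).unique hc hy.symm
      simp at this
  · have hex : ∀ i : Fin (g v), ∃ p : P, M.Adj (.inl ⟨v, i⟩) (.inr p) := fun i => by
      obtain ⟨y, hy, -⟩ := hM' (.inl ⟨v, i⟩)
      rcases y with c' | q
      · exact absurd hy.adj_sub factorGadget_adj_inl_inl
      · exact ⟨q, hy⟩
    choose φ hφ using hex
    have hinj : Function.Injective φ := fun i j hij => by
      have h1 := (hM' (.inr (φ i))).unique (hφ i).symm (hij ▸ (hφ j).symm)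
      simpa using h1
    have hrange : {p ∈ {p | ∃ c, M.Adj (.inr p) (.inl c)} | src p = v} = Set.range φ := by
      ext p
      constructor
      · rintro ⟨⟨⟨w, i⟩, hc⟩, hp⟩
        have hw : src p = w := factorGadget_adj_inr_inl.1 hc.adj_sub
        obtain rfl : w = v := hw ▸ hp
        have := (hM' (.inl ⟨w, i⟩)).unique (hφ i) hc.symm
        exact ⟨i, by simpa using this⟩
      · rintro ⟨i, rfl⟩
        exact ⟨⟨_, (hφ i).symm⟩, factorGadget_adj_inl_inr.1 (hφ i).adj_sub⟩
    rw [hrange, ← Set.image_univ, Set.ncard_image_of_injective _ hinj, Set.ncard_univ,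
      Nat.card_eq_fintype_card, Fintype.card_fin]

lemma even_card_of_involutive [Fintype P] (hrev : Function.Involutive rev) (hne : ∀ p, rev p ≠ p) :
    Even (Fintype.card P) := by
  have : ∑ _p : P, (1 : ZMod 2) = 0 :=
    Finset.sum_involution (fun p _ => rev p) (fun _ _ => by decide) (fun p _ _ => hne p)
      (fun _ _ => Finset.mem_univ _) (fun p _ => hrev p)
  rw [Finset.sum_const, nsmul_one, Finset.card_univ] at this
  exact (ZMod.natCast_eq_zero_iff_even).1 this

lemma touchingComponents_ncard_le_of_subset {W : Type*} [Finite W] (K : SimpleGraph W)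
    {X : Set W} {x : W} {s : Set (K.induce X).ConnectedComponent}
    (h : ∀ y (hy : y ∈ X), K.Adj x y → (K.induce X).connectedComponentMk ⟨y, hy⟩ ∈ s) :
    (K.touchingComponents X x).ncard ≤ s.ncard := by
  refine Set.ncard_le_ncard ?_ (Set.toFinite _)
  rintro _ ⟨y, hy, rfl⟩
  exact h y.1 y.2 hy

variable [Fintype V] [Fintype P]

/-- If every vertex of `U` has neighbours in three components of the rest of the gadget, then `U`
consists of all copies of some vertices and of all darts starting in some other vertices. -/
lemma factorGadget_inl_mem {U : Set ((Σ v, Fin (g v)) ⊕ P)}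
    (hU : ∀ x ∈ U, 3 ≤ ((factorGadget g src rev).touchingComponents Uᶜ x).ncard)
    {v : V} {i : Fin (g v)} (hi : .inl ⟨v, i⟩ ∈ U) (j : Fin (g v)) : .inl ⟨v, j⟩ ∈ U := by
  by_contra hj
  -- Copies of `v` have the same neighbours, so a copy outside `U` joins all surviving neighbours
  -- into one component.
  have h := touchingComponents_ncard_le_of_subset (factorGadget g src rev) (X := Uᶜ)
    (x := .inl ⟨v, i⟩) (s := {connectedComponentMk _ ⟨.inl ⟨v, j⟩, hj⟩}) (by
      rintro (c | p) hy hadj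
      · exact absurd hadj factorGadget_adj_inl_inl
      · have hp : src p = v := factorGadget_adj_inl_inr.1 hadj
        refine ConnectedComponent.sound (Adj.reachable ?_)
        exact (factorGadget_adj_inr_inl (rev := rev) (c := ⟨v, j⟩)).2 hp)
  rw [Set.ncard_singleton] at h
  have := hU _ hi
  omega

lemma factorGadget_inr_mem (hrev : Function.Involutive rev) (hne : ∀ p, rev p ≠ p)
    {U : Set ((Σ v, Fin (g v)) ⊕ P)}
    (hU : ∀ x ∈ U, 3 ≤ ((factorGadget g src rev).touchingComponents Uᶜ x).ncard)
    {p : P} (hp : .inr p ∈ U) :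
    (∃ i, Sum.inl ⟨src p, i⟩ ∉ U) ∧ ∀ q, src q = src p → .inr q ∈ U := by
  -- If the surviving copies of the source lay in one component, `p` would touch at most that one
  -- and the one of `rev p`. A surviving dart from the same source would force this.
  have key : ∀ C : (induce Uᶜ (factorGadget g src rev)).ConnectedComponent,
      ¬ ∀ i (hi : Sum.inl ⟨src p, i⟩ ∉ U), connectedComponentMk _ ⟨_, hi⟩ = C := by
    intro C hC
    have h : ∃ s : Set (induce Uᶜ (factorGadget g src rev)).ConnectedComponent, s.ncard ≤ 2 ∧
        ∀ y (hy : y ∈ Uᶜ), (factorGadget g src rev).Adj (.inr p) y →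
          connectedComponentMk _ ⟨y, hy⟩ ∈ s := by
      by_cases hr : Sum.inr (rev p) ∈ U
      · refine ⟨{C}, by simp, ?_⟩
        rintro (⟨v, i⟩ | q) hy hadj
        · obtain rfl : src p = v := factorGadget_adj_inr_inl.1 hadj
          exact hC i hy
        · rw [factorGadget_adj_inr_inr hrev hne] at hadj
          exact absurd (hadj ▸ hr) hy
      · refine ⟨{C, connectedComponentMk _ ⟨_, hr⟩}, (Set.ncard_insert_le _ _).trans (by simp), ?_⟩
        rintro (⟨v, i⟩ | q) hy hadj
        · obtain rfl : src p = v := factorGadget_adj_inr_inl.1 hadj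
          exact Or.inl (hC i hy)
        · rw [factorGadget_adj_inr_inr hrev hne] at hadj
          subst hadj
          exact Or.inr rfl
    obtain ⟨s, hs, h⟩ := h
    have h1 := touchingComponents_ncard_le_of_subset (factorGadget g src rev) h
    have := hU _ hp
    omega
  constructor
  · by_contra! hall
    have h3 := hU _ hp
    obtain ⟨C, hC⟩ : ((factorGadget g src rev).touchingComponents Uᶜ (.inr p)).Nonempty :=
      (Set.ncard_pos (Set.toFinite _)).1 (by omega)
    exact key C fun i hi => absurd (hall i) hi
  · intro q hq
    by_contra hqU
    refine key (connectedComponentMk _ ⟨_, hqU⟩) fun i hi =>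
      ConnectedComponent.sound (Adj.reachable ?_)
    exact (factorGadget_adj_inl_inr (rev := rev)).2 hq

/-- **Tutte's `f`-factor theorem** (sufficiency), with the number of odd components replaced by the
number of all components. -/
theorem exists_factor [DecidableEq V] (hrev : Function.Involutive rev)
    (hne : ∀ p, rev p ≠ p) (D : SimpleGraph V)
    (hD : ∀ v w, D.Adj v w → ∃ p, src p = v ∧ src (rev p) = w)
    (hg : ∀ v, 0 < g v) (heven : Even (∑ v, g v))
    (h : ∀ S T : Finset V, Disjoint S T →
      D.inducedComponents (↑(S ∪ T) : Set V)ᶜ + ∑ v ∈ T, g v ≤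
        ∑ v ∈ S, g v + (Finset.univ.filter fun p => src p ∈ T ∧ src (rev p) ∉ S).card + 1) :
    ∃ Q : Set P, (∀ p ∈ Q, rev p ∈ Q) ∧ ∀ v, {p ∈ Q | src p = v}.ncard = g v := by
  classical
  by_contra hno
  have hW : Even (Nat.card ((Σ v, Fin (g v)) ⊕ P)) := by
    rw [Nat.card_eq_fintype_card, Fintype.card_sum, Fintype.card_sigma]
    simpa using heven.add (even_card_of_involutive hrev hne)
  obtain ⟨U, hUodd, hU⟩ := (factorGadget g src rev).exists_minimal_tutteViolator hW
    fun M hM => hno (exists_factor_of_isPerfectMatching hrev hne hM)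
  set S : Finset V := Finset.univ.filter fun v => ∀ i, Sum.inl ⟨v, i⟩ ∈ U with hS
  set T : Finset V := Finset.univ.filter fun v => v ∉ S ∧ ∀ p, src p = v → Sum.inr p ∈ U with hT
  have hST : Disjoint S T := Finset.disjoint_left.2 fun v hv hv' =>
    (Finset.mem_filter.1 hv').2.1 hv
  have hinl : ∀ v i, Sum.inl ⟨v, i⟩ ∈ U ↔ v ∈ S := fun v i => by
    simp only [hS, Finset.mem_filter, Finset.mem_univ, true_and]
    exact ⟨fun hi j => factorGadget_inl_mem hU hi j, fun hv => hv i⟩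
  have hinr : ∀ p, Sum.inr p ∈ U ↔ src p ∈ T := fun p => by
    simp only [hT, Finset.mem_filter, Finset.mem_univ, true_and]
    refine ⟨fun hp => ?_, fun hp => hp.2 p rfl⟩
    obtain ⟨⟨i, hi⟩, hall⟩ := factorGadget_inr_mem hrev hne hU hp
    exact ⟨fun hv => hi ((hinl _ i).2 hv), hall⟩
  have hcardU : ∑ v ∈ S, g v + (Finset.univ.filter fun p => src p ∈ T).card ≤ U.ncard := by
    have : (S.sigma fun v => (Finset.univ : Finset (Fin (g v)))).disjSum
        (Finset.univ.filter fun p => src p ∈ T) = U.toFinset := by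
      ext x
      rcases x with ⟨v, i⟩ | p
      · simp [hinl]
      · simp [hinr]
    rw [Set.ncard_eq_toFinset_card', ← this, Finset.card_disjSum, Finset.card_sigma]
    simp
  set K := (factorGadget g src rev).induce Uᶜ with hK
  set R : Set V := (↑(S ∪ T) : Set V)ᶜ with hR
  have hRS : ∀ r : R, (r : V) ∉ S := fun r hr => r.2 (by simp [hr])
  have hRT : ∀ r : R, (r : V) ∉ T := fun r hr => r.2 (by simp [hr])
  -- Positivity of `g` provides the copy 0 as a representative.
  let copy : R → K.ConnectedComponent := fun r =>
    K.connectedComponentMk ⟨.inl ⟨r, ⟨0, hg r⟩⟩, fun hr => hRS r ((hinl _ _).1 hr)⟩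
  have hport : ∀ (p : P) (hp : src p ∈ R),
      copy ⟨src p, hp⟩ = K.connectedComponentMk ⟨.inr p, fun h => hRT ⟨_, hp⟩ ((hinr p).1 h)⟩ :=
    fun p hp => ConnectedComponent.sound (Adj.reachable ((factorGadget_adj_inl_inr (rev := rev)).2 rfl))
  have hpair : ∀ (p : P) (hp : Sum.inr p ∉ U) (hq : Sum.inr (rev p) ∉ U),
      K.connectedComponentMk ⟨_, hp⟩ = K.connectedComponentMk ⟨_, hq⟩ := fun p hp hq =>
    ConnectedComponent.sound (Adj.reachable ((factorGadget_adj_inr_inr (src := src) hrev hne).2 rfl))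
  have hadj : ∀ r r' : R, D.Adj r r' → copy r = copy r' := by
    rintro ⟨r, hr⟩ ⟨r', hr'⟩ hrr
    obtain ⟨p, rfl, rfl⟩ := hD _ _ hrr
    rw [hport, hport, hpair]
  have hcopy : ∀ r : R, copy ((D.induce R).connectedComponentMk r).out = copy r := fun r => by
    have : (D.induce R).Reachable r ((D.induce R).connectedComponentMk r).out :=
      ConnectedComponent.exact (Quot.out_eq _).symm
    exact this.mem_of_closed (P := {r' | copy r' = copy r})
      (fun a ha b hab => (hadj a b hab).symm.trans ha) rfl
  set Y1 := {c : Σ v, Fin (g v) // c.1 ∈ T}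
  set Y2 := {p : P // src p ∈ T ∧ src (rev p) ∈ S}
  -- Every odd component comes from a copy of a vertex of `T`, a dart from `S` to `T`, or a
  -- component of the graph on `R`.
  let Φ : Y1 ⊕ Y2 ⊕ (D.induce R).ConnectedComponent → K.ConnectedComponent := fun y =>
    match y with
    | .inl c => K.connectedComponentMk ⟨.inl c.1, fun hc =>
        Finset.disjoint_left.1 hST ((hinl _ _).1 hc) c.2⟩
    | .inr (.inl p) => K.connectedComponentMk ⟨.inr (rev p.1), fun hp =>
        Finset.disjoint_left.1 hST p.2.2 ((hinr _).1 hp)⟩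
    | .inr (.inr C) => copy C.out
  have hΦR : ∀ r : R, copy r ∈ Set.range Φ := fun r =>
    ⟨.inr (.inr ((D.induce R).connectedComponentMk r)), hcopy r⟩
  have hsurj : K.oddComponents ⊆ Set.range Φ := by
    intro c hc
    induction c using ConnectedComponent.ind with | _ x
    obtain ⟨⟨v, i⟩ | p, hx⟩ := x
    · by_cases hvT : v ∈ T
      · exact ⟨.inl ⟨⟨v, i⟩, hvT⟩, rfl⟩
      · have hvS : v ∉ S := fun h => hx ((hinl v i).2 h)
        have hvR : v ∈ R := by simp [hR, hvS, hvT]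
        have : ∃ p, src p = v ∧ Sum.inr p ∉ U := by
          by_contra! hall
          exact hvT (by simp only [hT, Finset.mem_filter, Finset.mem_univ, true_and]
                        exact ⟨hvS, hall⟩)
        obtain ⟨p, rfl, hp⟩ := this
        have h1 : K.connectedComponentMk ⟨_, hx⟩ = copy ⟨_, hvR⟩ := by
          rw [hport]
          exact ConnectedComponent.sound (Adj.reachable ((factorGadget_adj_inl_inr (rev := rev)).2 rfl))
        exact h1 ▸ hΦR _
    · have hpT : src p ∉ T := fun h => hx ((hinr p).2 h)
      by_cases hpS : src p ∈ S
      · by_cases hqT : src (rev p) ∈ T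
        · refine ⟨.inr (.inl ⟨rev p, hqT, by rwa [hrev]⟩), ?_⟩
          simp only [Φ, hrev p]
        have hq : Sum.inr (rev p) ∉ U := fun h => hqT ((hinr _).1 h)
        by_cases hqS : src (rev p) ∈ S
        -- An edge inside `S` leaves just its two darts, an even component.
        · have hsupp : (K.connectedComponentMk ⟨.inr p, hx⟩).supp =
              {⟨.inr p, hx⟩, ⟨.inr (rev p), hq⟩} := by
            apply Set.Subset.antisymm
            · intro y hy
              have hy : K.Reachable ⟨.inr p, hx⟩ y := (ConnectedComponent.exact hy).symm
              refine hy.mem_of_closed ?_ (Or.inl rfl)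
              have hout : ∀ q, src q ∈ S → ∀ hq' : Sum.inr q ∉ U, ∀ b, K.Adj ⟨.inr q, hq'⟩ b →
                  b.1 = .inr (rev q) := by
                rintro q hqS hq' ⟨⟨v, i⟩ | q', hb⟩ hab
                · have : src q = v := (factorGadget_adj_inr_inl (rev := rev)).1 hab
                  exact absurd ((hinl v i).2 (this ▸ hqS)) hb
                · have := (factorGadget_adj_inr_inr (src := src) hrev hne).1 hab
                  simp [this]
              rintro a (rfl | rfl) b hab
              · exact Or.inr (Subtype.ext (hout p hpS hx b hab))
              · refine Or.inl (Subtype.ext ?_)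
                rw [hout _ hqS hq b hab, hrev]
            · rintro y (rfl | rfl)
              · rfl
              · exact (hpair p hx hq).symm
          have hc : Odd (K.connectedComponentMk ⟨.inr p, hx⟩).supp.ncard := hc
          rw [hsupp, Set.ncard_pair (by
            intro h; exact hne p (Sum.inr_injective (congrArg Subtype.val h)).symm)] at hc
          exact absurd hc (by decide)
        · have hqR : src (rev p) ∈ R := by simp [hR, hqS, hqT]
          rw [hpair p hx hq, ← hport (rev p) hqR]
          exact hΦR _
      · have hpR : src p ∈ R := by simp [hR, hpS, hpT]
        rw [← hport p hpR]
        exact hΦR _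
  have hodd : K.oddComponents.ncard ≤ ∑ v ∈ T, g v +
      ((Finset.univ.filter fun p => src p ∈ T ∧ src (rev p) ∈ S).card + D.inducedComponents R) := by
    refine (Set.ncard_le_ncard hsurj (Set.toFinite _)).trans ?_
    rw [← Set.image_univ]
    refine (Set.ncard_image_le (Set.toFinite _)).trans (le_of_eq ?_)
    rw [Set.ncard_univ, Nat.card_sum, Nat.card_sum]
    congr 1
    · rw [Nat.card_eq_fintype_card, Fintype.card_subtype]
      have : (Finset.univ.filter fun c : Σ v, Fin (g v) => c.1 ∈ T) =
          T.sigma fun v => (Finset.univ : Finset (Fin (g v))) := by ext; simp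
      rw [this, Finset.card_sigma]
      simp
    · rw [Nat.card_eq_fintype_card, Fintype.card_subtype]
      rfl
  -- Darts from `T` to `S` cancel between |U| and the odd count, leaving degrees outside `S`.
  have hsplit : (Finset.univ.filter fun p => src p ∈ T).card =
      (Finset.univ.filter fun p => src p ∈ T ∧ src (rev p) ∈ S).card +
      (Finset.univ.filter fun p => src p ∈ T ∧ src (rev p) ∉ S).card := by
    rw [← Finset.card_filter_add_card_filter_not (s := Finset.univ.filter fun p => src p ∈ T)
      (fun p => src (rev p) ∈ S), Finset.filter_filter, Finset.filter_filter]
  have : D.inducedComponents R + ∑ v ∈ T, g v ≤ _ := h S T hST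
  omega

/-- If the surplus condition holds for the weights `f + κ` whenever `∑ κ ≤ 1`, then there is a set
of edges whose degrees are `f + κ` for such a `κ`. -/
theorem exists_near_factor [DecidableEq V] (hrev : Function.Involutive rev)
    (hne : ∀ p, rev p ≠ p) (D : SimpleGraph V)
    (hD : ∀ v w, D.Adj v w → ∃ p, src p = v ∧ src (rev p) = w)
    (f : V → ℕ) (hf : ∀ v, 0 < f v) (ε : ℝ) (hε0 : 0 < ε) (hε1 : ε ≤ 1)
    (hiso : ∀ S I : Finset V, (∀ v ∈ I, v ∉ S ∧ ∀ w, D.Adj v w → w ∈ S) →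
      ∑ v ∈ I, (f v : ℝ) * (f v + 1) / ε ≤ S.card)
    (hcomp : ∀ S : Finset V,
      (D.inducedComponents (↑S : Set V)ᶜ : ℝ) < ∑ v ∈ S, ((f v : ℝ) - ε) + 2) :
    ∃ κ : V → ℕ, ∑ v, κ v ≤ 1 ∧
      ∃ Q : Set P, (∀ p ∈ Q, rev p ∈ Q) ∧ ∀ v, {p ∈ Q | src p = v}.ncard = f v + κ v := by
  classical
  obtain ⟨κ, hκ, heven⟩ : ∃ κ : V → ℕ, ∑ v, κ v ≤ 1 ∧ Even (∑ v, (f + κ) v) := by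
    rcases Nat.even_or_odd (∑ v, f v) with h | h
    · exact ⟨0, by simp, by simpa using h⟩
    · obtain ⟨u, -, -⟩ := Finset.exists_ne_zero_of_sum_ne_zero (Nat.ne_of_odd_add (n := 0) h)
      refine ⟨Pi.single u 1, by simp, ?_⟩
      simp only [Pi.add_apply, Finset.sum_add_distrib]
      rw [Finset.sum_pi_single']
      simpa using h.add_one
  refine ⟨κ, hκ, exists_factor (g := f + κ) hrev hne D hD
    (fun v => Nat.add_pos_left (hf v) _) heven fun S T hST => ?_⟩
  let m : V → V → ℕ := fun v w => (Finset.univ.filter fun p => src p = v ∧ src (rev p) = w).card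
  have hm : ∀ v w, D.Adj v w → 1 ≤ m v w := fun v w hvw => by
    obtain ⟨p, hp⟩ := hD v w hvw
    exact Finset.card_pos.2 ⟨p, by simpa using hp⟩
  have h := neg_one_le_surplus D m hm f κ hf hκ ε hε0 hε1 hiso hcomp S T hST
  have hcount : (Finset.univ.filter fun p => src p ∈ T ∧ src (rev p) ∉ S).card =
      ∑ v ∈ T, ∑ w ∈ Sᶜ, m v w := by
    rw [Finset.card_eq_sum_card_fiberwise (f := fun p => (src p, src (rev p))) (t := T ×ˢ Sᶜ)
      (by intro p hp; simpa using hp), Finset.sum_product]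
    refine Finset.sum_congr rfl fun v hv => Finset.sum_congr rfl fun w hw => ?_
    rw [Finset.filter_filter]
    congr 1
    ext p
    simp only [Finset.mem_filter, Finset.mem_univ, true_and, Prod.mk.injEq]
    rw [Finset.mem_compl] at hw
    constructor
    · exact fun h => h.2
    · rintro ⟨rfl, rfl⟩
      exact ⟨⟨hv, hw⟩, rfl, rfl⟩
  -- The surplus weighs `S` by `f` only, so its bound is stronger than needed.
  have hS : ∑ v ∈ S, f v ≤ ∑ v ∈ S, (f + κ) v := Finset.sum_le_sum fun v _ => Nat.le_add_right _ _
  unfold surplus at h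
  rw [Finset.sum_sub_distrib] at h
  zify at hcount hS ⊢
  simp only [Finset.coe_union] at h ⊢
  linarith

end Gadget

end SimpleGraph

/-! ### Transfer to multigraphs through darts. -/

namespace Graph

variable {α β : Type*}

/-- The darts of `G`: edges together with one of their ends. -/
def DartOf (G : Graph α β) : Type _ := {p : β × G.vertexSet // G.Inc p.1 p.2}

namespace DartOf

variable {G : Graph α β}

/-- The source of a dart. -/
def src (p : G.DartOf) : G.vertexSet := p.1.2

/-- The dart on the same edge from the other end. -/
noncomputable def rev (p : G.DartOf) : G.DartOf :=
  ⟨(p.1.1, ⟨p.2.other, p.2.isLink_other.right_mem⟩), p.2.inc_other⟩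

lemma isLink (p : G.DartOf) : G.IsLink p.1.1 p.src p.rev.src := p.2.isLink_other

lemma rev_involutive : Function.Involutive (rev (G := G)) := fun p => by
  refine Subtype.ext (Prod.ext rfl (Subtype.ext ?_))
  exact p.rev.isLink.right_unique p.isLink.symm

lemma rev_ne [G.Loopless] (p : G.DartOf) : p.rev ≠ p := fun h =>
  p.isLink.ne (congrArg (fun q => (q.src : α)) h).symm

lemma finite (hV : G.vertexSet.Finite) (hE : G.edgeSet.Finite) : Finite G.DartOf := by
  have := hV.to_subtype
  have := hE.to_subtype
  exact Finite.of_injective (β := G.edgeSet × G.vertexSet)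
    (fun p => (⟨p.1.1, p.2.edge_mem⟩, p.src))
    fun p q h => Subtype.ext (Prod.ext (congrArg (fun z => (z.1 : β)) h) (congrArg (fun z => z.2) h))

end DartOf

lemma numComponents_deleteVerts (G : Graph α β) (S : Set G.vertexSet) :
    (G.deleteVerts (Subtype.val '' S)).numComponents = G.toSimpleGraph.inducedComponents Sᶜ := by
  have hmem : ∀ v : (G.deleteVerts (Subtype.val '' S)).vertexSet,
      v.1 ∈ G.vertexSet \ Subtype.val '' S := fun v => (vertexSet_deleteVerts G _).subset v.2
  let φ : (G.deleteVerts (Subtype.val '' S)).toSimpleGraph ≃g G.toSimpleGraph.induce Sᶜ :=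
    { toFun := fun v => ⟨⟨v.1, (hmem v).1⟩, fun h => (hmem v).2 ⟨_, h, rfl⟩⟩
      invFun := fun v => ⟨v.1.1, (vertexSet_deleteVerts G _).superset ⟨v.1.2, by
        rintro ⟨w, hw, h⟩
        exact v.2 (Subtype.ext h ▸ hw)⟩⟩
      left_inv := fun v => rfl
      right_inv := fun v => rfl
      map_rel_iff' := fun {v w} => by
        have hadj : (G.deleteVerts (Subtype.val '' S)).Adj v w ↔ G.Adj v w :=
          exists_congr fun e => by
            rw [deleteVerts_isLink]
            exact ⟨fun h => h.1, fun h => ⟨h, (hmem v).2, (hmem w).2⟩⟩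
        rw [toSimpleGraph_adj, hadj]
        refine and_congr (not_congr ⟨fun h => ?_, fun h => ?_⟩) Iff.rfl
        · exact Subtype.ext (congrArg (fun z : G.vertexSet => (z : α)) h)
        · exact Subtype.ext (congrArg (fun z => z.1) h) }
  exact Nat.card_congr φ.connectedComponentEquiv

theorem exists_isNearFactor (G : Graph α β) [G.Loopless]
    (hV : G.vertexSet.Finite) (hE : G.edgeSet.Finite)
    (f : α → ℕ) (hf : ∀ v ∈ G.vertexSet, 0 < f v) (ε : ℝ) (hε0 : 0 < ε) (hε1 : ε ≤ 1)
    (hiso : G.IsoTough (fun v => (f v : ℝ) * ((f v : ℝ) + 1) / ε))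
    (hcomp : ∀ S : Set α, S ⊆ G.vertexSet →
        ((G.deleteVerts S).numComponents : ℝ) < (∑ᶠ v ∈ S, ((f v : ℝ) - ε)) + 2) :
    ∃ F : Graph α β, F.IsNearFactor G f := by
  classical
  have := hV.fintype
  have := DartOf.finite hV hE
  have := Fintype.ofFinite G.DartOf
  have hfin : ∀ (S : Finset G.vertexSet) (t : α → ℝ),
      ∑ᶠ v ∈ Subtype.val '' (S : Set G.vertexSet), t v = ∑ v ∈ S, t v := fun S t => by
    rw [finsum_mem_image Subtype.val_injective.injOn, finsum_mem_coe_finset]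
  have hsub : ∀ S : Finset G.vertexSet, Subtype.val '' (S : Set G.vertexSet) ⊆ G.vertexSet :=
    fun S => Subtype.coe_image_subset _ _
  obtain ⟨κ, hκ, Q, hQ, hdeg⟩ := SimpleGraph.exists_near_factor (V := G.vertexSet) (P := G.DartOf)
    (src := DartOf.src) DartOf.rev_involutive DartOf.rev_ne G.toSimpleGraph
    (by
      rintro v w ⟨-, e, he⟩
      refine ⟨⟨(e, v), he.inc_left⟩, rfl, Subtype.ext ?_⟩
      exact (DartOf.isLink ⟨(e, v), he.inc_left⟩).right_unique he)
    (fun v => f v) (fun v => hf v v.2) ε hε0 hε1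
    (by
      intro S I hI
      refine le_trans ?_ ((hiso _ (hsub S)).trans_eq ?_)
      · have hfi : (G.deleteVerts (Subtype.val '' (S : Set G.vertexSet))).isolatedVerts.Finite :=
          hV.subset fun v hv =>
            ((vertexSet_deleteVerts G _).subset hv.1).1
        rw [← hfin I (fun v => (f v : ℝ) * ((f v : ℝ) + 1) / ε),
          finsum_mem_eq_finite_toFinset_sum _ ((Set.toFinite _).image _),
          finsum_mem_eq_finite_toFinset_sum _ hfi]
        refine Finset.sum_le_sum_of_subset_of_nonneg ?_ fun _ _ _ => by positivity
        refine (Set.Finite.toFinset_subset_toFinset).2 ?_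
        rintro _ ⟨v, hv, rfl⟩
        obtain ⟨hvS, hvw⟩ := hI v hv
        refine ⟨by simpa using hvS, ?_⟩
        rintro e ⟨w, hw⟩
        rw [deleteVerts_isLink] at hw
        exact hw.2.2 ⟨⟨w, hw.1.right_mem⟩, hvw ⟨w, hw.1.right_mem⟩
          ⟨fun h => hw.1.ne (congrArg Subtype.val h), e, hw.1⟩, rfl⟩
      · rw [Set.ncard_image_of_injective _ Subtype.val_injective, Set.ncard_coe_finset])
    (by
      intro S
      have := hcomp _ (hsub S)
      rwa [numComponents_deleteVerts, hfin S (fun v => (f v : ℝ) - ε)] at this)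
  -- As `Q` is closed under reversal, the chosen edges at `v` correspond exactly to the darts of `Q`
  -- with source `v`.
  set F := G.restrict {e | ∃ p ∈ Q, p.1.1 = e} with hF
  have hFdeg : ∀ v : G.vertexSet, F.numIncEdges v = f v + κ v := fun v => by
    rw [← hdeg v]
    have : {e | F.Inc e v} = (fun p : G.DartOf => p.1.1) '' {p ∈ Q | p.src = v} := by
      ext e
      constructor
      · intro he
        obtain ⟨hev, p, hp, rfl⟩ := restrict_inc.1 he
        rcases hev.eq_or_eq_of_isLink p.isLink with h | h
        · exact ⟨p, ⟨hp, Subtype.ext h.symm⟩, rfl⟩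
        · exact ⟨p.rev, ⟨hQ p hp, Subtype.ext h.symm⟩, rfl⟩
      · rintro ⟨p, ⟨hp, rfl⟩, rfl⟩
        exact restrict_inc.2 ⟨p.2, p, hp, rfl⟩
    rw [numIncEdges, this, Set.InjOn.ncard_image]
    rintro p ⟨-, hp⟩ q ⟨-, hq⟩ h
    exact Subtype.ext (Prod.ext h (hp.trans hq.symm))
  refine ⟨F, ⟨restrict_le, rfl⟩, ?_⟩
  by_cases h0 : ∀ v, κ v = 0
  · exact Or.inl fun v hv => by rw [hFdeg ⟨v, hv⟩, h0, add_zero]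
  · push Not at h0
    obtain ⟨u, hu⟩ := h0
    have hle : ∀ v, v ≠ u → κ u + κ v ≤ 1 := fun v hv => by
      rw [← Finset.sum_pair hv.symm]
      exact (Finset.sum_le_sum_of_subset (Finset.subset_univ _)).trans hκ
    have hu1 : κ u ≤ 1 :=
      (Finset.single_le_sum (f := κ) (fun _ _ => Nat.zero_le _) (Finset.mem_univ u)).trans hκ
    refine Or.inr ⟨u, u.2, by rw [hFdeg u]; omega, fun v hv hvu => ?_⟩
    have := hle ⟨v, hv⟩ fun h => hvu (congrArg Subtype.val h)
    rw [hFdeg ⟨v, hv⟩]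
    simp only
    omega

end Graph

theorem mainTheorem8 {α β : Type*} (G : Graph α β) [G.Loopless]
    (hV : G.vertexSet.Finite) (hE : G.edgeSet.Finite)
    (f : α → ℕ) (hf : ∀ v ∈ G.vertexSet, 0 < f v) :
    (∀ ε : ℝ, 0 < ε → ε ≤ 1 →
      G.IsoTough (fun v => (f v : ℝ) * ((f v : ℝ) + 1) / ε) →
      (∀ S : Set α, S ⊆ G.vertexSet →
        ((G.deleteVerts S).numComponents : ℝ) < (∑ᶠ v ∈ S, ((f v : ℝ) - ε)) + 2) →
      ∃ F : Graph α β, F.IsNearFactor G f) ∧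
    (G.IsoTough (fun v => (f v : ℝ) * ((f v : ℝ) + 1)) →
      (∀ S : Set α, S ⊆ G.vertexSet →
        ((G.deleteVerts S).numComponents : ℤ) ≤ (∑ᶠ v ∈ S, ((f v : ℤ) - 1)) + 1) →
      ∃ F : Graph α β, F.IsNearFactor G f) := by
  refine ⟨fun ε hε0 hε1 hiso hcomp => G.exists_isNearFactor hV hE f hf ε hε0 hε1 hiso hcomp,
    fun hiso hcomp => G.exists_isNearFactor hV hE f hf 1 one_pos le_rfl (by simpa using hiso) ?_⟩
  intro S hS
  have h := hcomp S hS
  have hSfin := hV.subset hS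
  rw [finsum_mem_eq_finite_toFinset_sum _ hSfin] at h ⊢
  have h' : ((G.deleteVerts S).numComponents : ℝ) ≤ ∑ v ∈ hSfin.toFinset, ((f v : ℝ) - 1) + 1 := by
    exact_mod_cast h
  -- At ε = 1 the bound with +1 implies the strict one with +2.
  linarith
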